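/- **Model.** A sporadic task $\tau_i=(C_i,D_i,T_i)$ has worst-case execution time $C_i>0$, relative deadline $D_i>0$ and minimum inter-arrival time $T_i\in(0,\infty]$, with $C_i\le D_i$ and $C_i\le T_i$; there is no relation between $D_i$ and $T_i$ (arbitrary deadlines), and $T_i=\infty$ means that the task releases at most one job. A task set may generate any sequence of jobs in which consecutive releases of $\tau_i$ are at least $T_i$ apart; a job of $\tau_i$ needs at most $C_i$ units of processor time and must be finished at most $D_i$ after its release. Jobs are scheduled preemptively, with free migration, on $M\ge 2$ identical processors, and at each time at most one job of each task is executed, on at most one processor. Running the platform at speed $s$ replaces each $C_i$ by $C_i/s$. A task set is feasible if each job sequence that it can generate has a schedule meeting all deadlines. Global deadline-monotonic scheduling (global DM) executes, at each time, the $M$ highest-priority tasks that have unfinished jobs (all such tasks if there are fewer than $M$), each task through its earliest unfinished job; tasks with smaller $D_i$ have higher priority, and ties are broken by an arbitrary fixed rule. Global DM has speedup bound $s>0$ if, for each task set that is feasible on $M$ processors of speed $1$, global DM meets all deadlines of all job sequences of that task set on $M$ processors of speed $s$. **Theorem.** Let $M\ge 2$. 1. For every tie-breaking rule, every speedup bound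 $s$ of global DM on $M$ processors for arbitrary-deadline task systems satisfies $s\ge 3-\frac{3}{M+1}$. 2. Let $\varepsilon=1/n$ with a positive integer $n$. For all sufficiently small $\eta>0$ (depending on $\varepsilon$ and $M$), let $\mathbf T^{ad}$ be the set of $2M+1$ tasks with $C_i=\frac{\varepsilon}{3},\ T_i=\varepsilon,\ D_i=1$ for $1\le i\le M$; $C_i=\frac13,\ T_i=\infty,\ D_i=1+\eta$ for $M+1\le i\le 2M$; $C_{2M+1}=\frac{1+\varepsilon}{3},\ T_{2M+1}=\infty,\ D_{2M+1}=1+2\eta$. - At speed $1$, when all tasks release their first job at time $0$ and later jobs as early as possible, and each job needs its worst-case execution time, global DM (with any tie-breaking) misses the deadline of $\tau_{2M+1}$. - At every speed $v\ge\frac{1+\varepsilon}{3}+\frac{1+\varepsilon}{3M}$, each job sequence of $\mathbf T^{ad}$ has a schedule that meets all deadlines and is semi-partitioned: $\tau_m$ and $\tau_{M+m}$ receive processor time only on processor $m$ ($1\le m\le M$), and $\tau_{2M+1}$ receives at most $C_{2M+1}/(Mv)$ units of processor time on each processor. -/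

import Mathlib

open scoped ENNReal

namespace GlobalDM

/-- A sporadic task: worst-case execution time `C`, relative deadline `D`, minimum inter-arrival
time `T`. The value `T = ⊤` describes a one-shot task, which releases at most one job. -/
structure Task where
  C : ℝ
  D : ℝ
  T : ℝ≥0∞

/-- Admissible parameters: `C, D, T > 0`, `C / D ≤ 1` and `C / T ≤ 1`. -/
def Task.Valid (a : Task) : Prop :=
  0 < a.C ∧ 0 < a.D ∧ 0 < a.T ∧ a.C ≤ a.D ∧ ENNReal.ofReal a.C ≤ a.T

/-- Running the platform at speed `s` turns the worst-case execution time `C` into `C / s`. -/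
noncomputable def atSpeed {N : ℕ} (s : ℝ) (τ : Fin N → Task) : Fin N → Task :=
  fun i => { C := (τ i).C / s, D := (τ i).D, T := (τ i).T }

/-- A job sequence of `N` tasks: job `j` of task `i` is released at time `release i j`
(`⊤` means that it is never released) and needs `exec i j` units of processor time. -/
structure Jobs (N : ℕ) where
  release : Fin N → ℕ → ℝ≥0∞
  exec : Fin N → ℕ → ℝ

/-- The job sequences that a sporadic task set can generate: consecutive releases of a task are
at least its minimum inter-arrival time apart, and no job exceeds the worst-case execution time. -/
def Jobs.Legal {N : ℕ} (τ : Fin N → Task) (J : Jobs N) : Prop :=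
  (∀ i j, J.release i j + (τ i).T ≤ J.release i (j + 1)) ∧
  ∀ i j, 0 < J.exec i j ∧ J.exec i j ≤ (τ i).C

/-- All tasks release their first job at time `0` and later jobs as early as possible, and each
job needs its worst-case execution time. -/
noncomputable def synchronous {N : ℕ} (τ : Fin N → Task) : Jobs N where
  release i j := (j : ℝ≥0∞) * (τ i).T
  exec i _ := (τ i).C

/-- At each time, each of the `M` processors is idle (`none`) or executes one job
(`some (i, j)`: job `j` of task `i`). Only times `t ≥ 0` matter. -/
structure Schedule (M N : ℕ) where
  run : Fin M → ℝ → Option (Fin N × ℕ)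
  measurableSet_run : ∀ m i j, MeasurableSet {t | run m t = some (i, j)}

/-- Processor time that job `j` of task `i` receives on processor `m` during `[0, t)`. -/
noncomputable def Schedule.serviceOn {M N : ℕ} (S : Schedule M N) (m : Fin M) (i : Fin N) (j : ℕ)
    (t : ℝ) : ℝ :=
  (MeasureTheory.volume ({u | S.run m u = some (i, j)} ∩ Set.Ico 0 t)).toReal

/-- Processor time that job `j` of task `i` receives in total during `[0, t)`. -/
noncomputable def Schedule.service {M N : ℕ} (S : Schedule M N) (i : Fin N) (j : ℕ) (t : ℝ) : ℝ :=
  ∑ m, S.serviceOn m i j t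

/-- Job `j` of task `i` is released by time `t` and not finished before `t`. -/
def Schedule.Pending {M N : ℕ} (S : Schedule M N) (J : Jobs N) (i : Fin N) (j : ℕ) (t : ℝ) :
    Prop :=
  J.release i j ≤ ENNReal.ofReal t ∧ S.service i j t < J.exec i j

/-- `S` is a schedule of the job sequence `J`: only pending jobs are executed, and at each time at
most one job of each task is executed, on at most one processor. Preemption and migration are
unrestricted. -/
def Schedule.IsScheduleOf {M N : ℕ} (S : Schedule M N) (J : Jobs N) : Prop :=
  (∀ t, 0 ≤ t → ∀ m i j, S.run m t = some (i, j) → S.Pending J i j t) ∧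
  ∀ t, 0 ≤ t → ∀ m m' i j j',
    S.run m t = some (i, j) → S.run m' t = some (i, j') → m = m'

/-- Job `j` of task `i`, if released at all, is finished by its absolute deadline. -/
def Schedule.MeetsDeadline {M N : ℕ} (S : Schedule M N) (τ : Fin N → Task) (J : Jobs N)
    (i : Fin N) (j : ℕ) : Prop :=
  J.release i j ≠ ⊤ → J.exec i j ≤ S.service i j ((J.release i j).toReal + (τ i).D)

/-- The task set can be feasibly scheduled on `M` unit-speed processors: each job sequence that it
can generate has a schedule in which all deadlines are met. -/
def Feasible {N : ℕ} (M : ℕ) (τ : Fin N → Task) : Prop :=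
  ∀ J : Jobs N, J.Legal τ →
    ∃ S : Schedule M N, S.IsScheduleOf J ∧ ∀ i j, S.MeetsDeadline τ J i j

/-- Feasibility by semi-partitioned scheduling: task `i` is statically divided into subtasks, the
one on processor `m` having execution time `b i m`. A task with a single nonzero entry is assigned
to one processor. -/
def SemiPartitionedFeasible {N : ℕ} (M : ℕ) (τ : Fin N → Task) (b : Fin N → Fin M → ℝ) : Prop :=
  (∀ i m, 0 ≤ b i m) ∧ (∀ i, ∑ m, b i m = (τ i).C) ∧
  ∀ J : Jobs N, J.Legal τ →
    ∃ S : Schedule M N, S.IsScheduleOf J ∧ (∀ i j, S.MeetsDeadline τ J i j) ∧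
      ∀ i j m t, S.serviceOn m i j t ≤ b i m

/-- Task `i` has an unfinished job at time `t`. -/
def Schedule.Active {M N : ℕ} (S : Schedule M N) (J : Jobs N) (i : Fin N) (t : ℝ) : Prop :=
  ∃ j, S.Pending J i j t

/-- `S` is the preemptive global fixed-priority schedule of `J`, where `prio i < prio k` means that
task `i` has higher priority than task `k`: at each time exactly the `M` highest-priority active
tasks (all of them if there are fewer) are executed, each through its earliest pending job. -/
def Schedule.IsGlobalFP {M N : ℕ} (S : Schedule M N) (J : Jobs N) (prio : Equiv.Perm (Fin N)) :
    Prop :=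
  S.IsScheduleOf J ∧
  ∀ t, 0 ≤ t → ∀ i j, (∃ m, S.run m t = some (i, j)) ↔
    (S.Pending J i j t ∧ (∀ j' < j, ¬ S.Pending J i j' t) ∧
      Set.ncard {k | S.Active J k t ∧ prio k < prio i} < M)

/-- Deadline-monotonic priorities: shorter relative deadlines get higher priority; ties may be
broken in any way. -/
def IsDM {N : ℕ} (τ : Fin N → Task) (prio : Equiv.Perm (Fin N)) : Prop :=
  ∀ i k, (τ i).D < (τ k).D → prio i < prio k

/-- Deadline-monotonic priority assignment with some rule for breaking ties. -/
structure DMRule where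
  assign : ∀ N : ℕ, (Fin N → Task) → Equiv.Perm (Fin N)
  isDM : ∀ N τ, IsDM τ (assign N τ)

/-- Global DM meets all deadlines of all job sequences that the task set can generate. -/
def DMSchedulable {N : ℕ} (M : ℕ) (rule : DMRule) (τ : Fin N → Task) : Prop :=
  ∀ J : Jobs N, J.Legal τ → ∀ S : Schedule M N, S.IsGlobalFP J (rule.assign N τ) →
    ∀ i j, S.MeetsDeadline τ J i j

/-- Global DM has speedup bound `s` on `M` processors: whenever a task set is feasible on `M`
processors of speed `1`, global DM schedules it on `M` processors of speed `s`. -/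
def HasSpeedupBound (M : ℕ) (rule : DMRule) (s : ℝ) : Prop :=
  0 < s ∧ ∀ (N : ℕ) (τ : Fin N → Task), (∀ i, (τ i).Valid) → Feasible M τ →
    DMSchedulable M rule (atSpeed s τ)

/-- The task set with `M` tasks `(ε/3, 1, ε)`, `M` one-shot tasks `(1/3, 1 + η, ∞)` and one
one-shot task `((1 + ε)/3, 1 + 2η, ∞)`, in the order `(C, D, T)`. -/
noncomputable def adTasks (M : ℕ) (ε η : ℝ) : Fin (2 * M + 1) → Task := fun i =>
  if i.val < M then { C := ε / 3, D := 1, T := ENNReal.ofReal ε }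
  else if i.val < 2 * M then { C := 1 / 3, D := 1 + η, T := ⊤ }
  else { C := (1 + ε) / 3, D := 1 + 2 * η, T := ⊤ }

/-- The static division that assigns tasks `m` and `M + m` to processor `m` and splits the last
task evenly among all processors. -/
noncomputable def adSplit (M : ℕ) (τ : Fin (2 * M + 1) → Task) (i : Fin (2 * M + 1)) (m : Fin M) :
    ℝ :=
  if i = Fin.last (2 * M) then (τ i).C / M
  else if i.val = m.val ∨ i.val = M + m.val then (τ i).C
  else 0

end GlobalDM

namespace GlobalDM

open MeasureTheory Set

/-! The lower bound rests on the set `adTasks`. At speed 1 the `M` periodic tasks run in lockstep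
and block all processors during the first third of each period. Up to time 1 this leaves time 2/3,
the same on every processor. The `M` one-shot tasks of middle priority run in lockstep as well and
use up 1/3 of it. The last task can run only in the remaining 1/3, however many processors are then
idle, and it needs `(1 + ε) / 3`. This is `exists_isGlobalFP_adTasks`.

The same tasks are feasible at a much lower speed `v` (`semiPartitionedFeasible_adTasks`). The last
task is cut into `M` equal pieces that run one after the other, one on each processor. Processor `m`
serves its piece first, then its one-shot task, then its periodic task in order of release. Because
the period is far shorter than the deadline, the periodic task tolerates an interruption of nearly a
full deadline: `le_measureReal_freeTimes` shows that its backlog never delays a job by more than the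
one-time interruption. Thus it suffices that one piece, one one-shot job and one periodic job
together fit into time 1, which is `v ≥ (1 + ε) / 3 * (1 + 1 / M)`.

As `ε → 0`, the ratio of the two speeds tends to `3 * M / (M + 1) = 3 - 3 / (M + 1)`, and rescaling
gives the bound (`le_of_hasSpeedupBound`). -/

/-- A family of sets, disjoint on each processor, describes a schedule. -/
theorem exists_schedule {M N : ℕ} (E : Fin M → Fin N → ℕ → Set ℝ)
    (hmeas : ∀ m i j, MeasurableSet (E m i j))
    (hdisj : ∀ m t i j i' j', t ∈ E m i j → t ∈ E m i' j' → i = i' ∧ j = j') :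
    ∃ S : Schedule M N, ∀ m i j t, S.run m t = some (i, j) ↔ t ∈ E m i j := by
  classical
  let run : Fin M → ℝ → Option (Fin N × ℕ) := fun m t =>
    if h : ∃ p : Fin N × ℕ, t ∈ E m p.1 p.2 then some h.choose else none
  have hrun : ∀ m i j t, run m t = some (i, j) ↔ t ∈ E m i j := by
    intro m i j t
    by_cases h : ∃ p : Fin N × ℕ, t ∈ E m p.1 p.2
    · simp only [run, dif_pos h, Option.some.injEq]
      constructor
      · intro hp
        have := h.choose_spec
        rw [hp] at this
        exact this
      · intro ht
        obtain ⟨h1, h2⟩ := hdisj m t _ _ _ _ h.choose_spec ht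
        exact Prod.ext h1 h2
    · simp only [run, dif_neg h, reduceCtorEq, false_iff]
      exact fun ht => h ⟨(i, j), ht⟩
  refine ⟨⟨run, fun m i j => ?_⟩, hrun⟩
  have : {t | run m t = some (i, j)} = E m i j := by
    ext t
    exact hrun m i j t
  rw [this]
  exact hmeas m i j

theorem serviceOn_eq {M N : ℕ} {S : Schedule M N} {E : Fin M → Fin N → ℕ → Set ℝ}
    (hS : ∀ m i j t, S.run m t = some (i, j) ↔ t ∈ E m i j) (m : Fin M) (i : Fin N) (j : ℕ)
    (t : ℝ) : S.serviceOn m i j t = volume.real (E m i j ∩ Ico 0 t) := by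
  have : {u | S.run m u = some (i, j)} = E m i j := by
    ext u
    exact hS m i j u
  rw [Schedule.serviceOn, this, measureReal_def]

/-! ### Greedy use of free processor time by a single job. -/

/-- The times at which a job with release time `r` and execution time `e` runs if it uses the free
times `A` as early as possible. -/
def greedy (A : Set ℝ) (r : ℝ≥0∞) (e : ℝ) : Set ℝ :=
  {t | t ∈ A ∧ 0 ≤ t ∧ r ≤ ENNReal.ofReal t ∧ volume.real (A ∩ Ico r.toReal t) < e}

theorem greedy_subset (A : Set ℝ) (r : ℝ≥0∞) (e : ℝ) : greedy A r e ⊆ A := fun _ h => h.1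

theorem measureReal_inter_Ico_mono (A : Set ℝ) (a : ℝ) :
    Monotone fun t => volume.real (A ∩ Ico a t) := fun _ _ h =>
  measureReal_mono (inter_subset_inter_right _ (Ico_subset_Ico_right h))
    (ne_top_of_le_ne_top (by simp) (measure_mono inter_subset_right))

theorem measureReal_inter_Ico_le (A : Set ℝ) (a : ℝ) {s t : ℝ} (h : s ≤ t) :
    volume.real (A ∩ Ico a t) ≤ volume.real (A ∩ Ico a s) + (t - s) := by
  have hsub : A ∩ Ico a t ⊆ (A ∩ Ico a s) ∪ Ico s t := by
    rintro u ⟨hu, h1, h2⟩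
    rcases lt_or_ge u s with h3 | h3
    · exact Or.inl ⟨hu, h1, h3⟩
    · exact Or.inr ⟨h3, h2⟩
  have hfin : volume (A ∩ Ico a s) ≠ ∞ :=
    ne_top_of_le_ne_top (by simp) (measure_mono inter_subset_right)
  calc volume.real (A ∩ Ico a t) ≤ volume.real ((A ∩ Ico a s) ∪ Ico s t) :=
        measureReal_mono hsub (measure_union_ne_top hfin (by simp))
    _ ≤ volume.real (A ∩ Ico a s) + volume.real (Ico s t) := measureReal_union_le _ _
    _ = _ := by rw [Real.volume_real_Ico_of_le h]

/-- Available time grows at rate at most 1. Continuity is what makes a greedy job receive exactly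
its demand. -/
theorem continuous_measureReal_inter_Ico (A : Set ℝ) (a : ℝ) :
    Continuous fun t => volume.real (A ∩ Ico a t) := by
  refine (LipschitzWith.of_le_add fun s t => ?_).continuous
  rcases le_total s t with h | h
  · exact (measureReal_inter_Ico_mono A a h).trans (le_add_of_nonneg_right dist_nonneg)
  · refine (measureReal_inter_Ico_le A a h).trans ?_
    rw [Real.dist_eq, abs_of_nonneg (by linarith)]

theorem measurableSet_greedy {A : Set ℝ} (hA : MeasurableSet A) (r : ℝ≥0∞) (e : ℝ) :
    MeasurableSet (greedy A r e) := by
  have h1 : MeasurableSet {t : ℝ | r ≤ ENNReal.ofReal t} :=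
    measurableSet_le measurable_const ENNReal.measurable_ofReal
  have h2 : MeasurableSet {t : ℝ | volume.real (A ∩ Ico r.toReal t) < e} :=
    measurableSet_lt (continuous_measureReal_inter_Ico A _).measurable measurable_const
  exact hA.inter (measurableSet_Ici.inter (h1.inter h2))

/-- The default value `⊤.toReal = 0` in `greedy` does no harm, since the condition on `r` already
excludes all times. -/
theorem greedy_top (A : Set ℝ) (e : ℝ) : greedy A ⊤ e = ∅ := by
  ext t
  simp [greedy]

/-- Before `x`, the job uses precisely `A ∩ [r, y)`, where `y` is the earlier of `x` and the
completion time. -/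
theorem measureReal_greedy_inter {A : Set ℝ} {r : ℝ≥0∞} (hr : r ≠ ⊤) {e : ℝ} (he : 0 < e)
    (x : ℝ) : volume.real (greedy A r e ∩ Ico 0 x) = min (volume.real (A ∩ Ico r.toReal x)) e := by
  set G : ℝ → ℝ := fun t => volume.real (A ∩ Ico r.toReal t) with hG
  have hmono : Monotone G := measureReal_inter_Ico_mono A _
  have hcont : Continuous G := continuous_measureReal_inter_Ico A _
  have hr0 : 0 ≤ r.toReal := ENNReal.toReal_nonneg
  have hGr : G r.toReal = 0 := by simp [hG]
  have key : ∀ y, y ≤ x → (∀ t < y, G t < e) → (∀ t, y ≤ t → t < x → e ≤ G t) →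
      greedy A r e ∩ Ico 0 x = A ∩ Ico r.toReal y := by
    intro y hyx hlt hge
    ext t
    constructor
    · rintro ⟨⟨h1, h2, h3, h4⟩, h5, h6⟩
      refine ⟨h1, (ENNReal.le_ofReal_iff_toReal_le hr h2).1 h3, ?_⟩
      by_contra h7
      exact absurd h4 (not_lt.2 (hge t (not_lt.1 h7) h6))
    · rintro ⟨h1, h2, h3⟩
      have h0 : 0 ≤ t := hr0.trans h2
      exact ⟨⟨h1, h0, (ENNReal.le_ofReal_iff_toReal_le hr h0).2 h2, hlt t h3⟩, h0,
        h3.trans_le hyx⟩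
  change _ = min (G x) e
  rcases lt_or_ge (G x) e with hx | hx
  · rw [key x le_rfl (fun t ht => (hmono ht.le).trans_lt hx) (fun t h1 h2 => by linarith),
      min_eq_left hx.le]
  · have hrx : r.toReal ≤ x := by
      by_contra h
      have := hmono (not_le.1 h).le
      linarith
    obtain ⟨y, ⟨⟨hy1, hy2⟩, hy3⟩, hy4⟩ :=
      (isCompact_Icc.inter_right (isClosed_Ici.preimage hcont)).exists_isLeast
        (s := Icc r.toReal x ∩ G ⁻¹' Ici e) ⟨x, ⟨hrx, le_rfl⟩, hx⟩
    obtain ⟨z, ⟨hz1, hz2⟩, hz3⟩ : e ∈ G '' Icc r.toReal y :=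
      intermediate_value_Icc hy1 hcont.continuousOn ⟨by rw [hGr]; exact he.le, hy3⟩
    have hyz : y = z := le_antisymm (hy4 ⟨⟨hz1, hz2.trans hy2⟩, hz3.ge⟩) hz2
    have hGy : G y = e := by rw [hyz, hz3]
    rw [key y hy2 ?_ fun t h1 _ => hGy.ge.trans (hmono h1), min_eq_right hx]
    · exact hGy
    · intro t ht
      by_contra h
      rcases le_total r.toReal t with h' | h'
      · exact absurd (hy4 ⟨⟨h', ht.le.trans hy2⟩, not_lt.1 h⟩) (not_le.2 ht)
      · have := hmono h'
        linarith

theorem measureReal_greedy_le {A : Set ℝ} {r : ℝ≥0∞} {e : ℝ} (he : 0 < e) (x : ℝ) :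
    volume.real (greedy A r e ∩ Ico 0 x) ≤ e := by
  by_cases hr : r = ⊤
  · simp [hr, greedy_top, he.le]
  · rw [measureReal_greedy_inter hr he]
    exact min_le_right _ _

theorem measureReal_greedy_lt {A : Set ℝ} {r : ℝ≥0∞} {e : ℝ} (he : 0 < e) {t : ℝ}
    (ht : t ∈ greedy A r e) : volume.real (greedy A r e ∩ Ico 0 t) < e := by
  have hr : r ≠ ⊤ := by
    rintro rfl
    simp [greedy_top] at ht
  rw [measureReal_greedy_inter hr he]
  exact (min_le_left _ _).trans_lt ht.2.2.2

/-- Removing `V` costs a window at most the total length of `V`, so the loads on a processor can be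
subtracted one by one. -/
theorem measureReal_inter_Ico_sub_le {A A' V : Set ℝ} (hsub : A \ V ⊆ A') {k s x : ℝ}
    (hs : 0 ≤ s) (hV : volume.real (V ∩ Ico 0 x) ≤ k) :
    volume.real (A ∩ Ico s x) - k ≤ volume.real (A' ∩ Ico s x) := by
  have h : A ∩ Ico s x ⊆ (A' ∩ Ico s x) ∪ (V ∩ Ico 0 x) := by
    rintro u ⟨hu, h1, h2⟩
    by_cases hv : u ∈ V
    · exact Or.inr ⟨hv, hs.trans h1, h2⟩
    · exact Or.inl ⟨hsub ⟨hu, hv⟩, h1, h2⟩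
  have := (measureReal_mono h (measure_union_ne_top
    (ne_top_of_le_ne_top (by simp) (measure_mono inter_subset_right))
    (ne_top_of_le_ne_top (by simp) (measure_mono inter_subset_right)))).trans
    (measureReal_union_le (μ := volume) _ _)
  linarith

/-! ### A queue of jobs served in order of release. -/

/-- The times left free by the first `j` jobs, when each job in turn greedily uses what the
previous ones leave of `A`. -/
def freeTimes (A : Set ℝ) (r : ℕ → ℝ≥0∞) (e : ℕ → ℝ) : ℕ → Set ℝ
  | 0 => A
  | j + 1 => freeTimes A r e j \ greedy (freeTimes A r e j) (r j) (e j)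

section FreeTimes

variable {A : Set ℝ} {r : ℕ → ℝ≥0∞} {e : ℕ → ℝ}

theorem measurableSet_freeTimes (hA : MeasurableSet A) (j : ℕ) :
    MeasurableSet (freeTimes A r e j) := by
  induction j with
  | zero => exact hA
  | succ j ih => exact ih.diff (measurableSet_greedy ih _ _)

theorem freeTimes_anti : Antitone (freeTimes A r e) :=
  antitone_nat_of_succ_le fun _ => sdiff_subset

theorem eq_of_mem_greedy_freeTimes {t : ℝ} {i j : ℕ}
    (hi : t ∈ greedy (freeTimes A r e i) (r i) (e i))
    (hj : t ∈ greedy (freeTimes A r e j) (r j) (e j)) : i = j := by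
  have key : ∀ a b, a < b → t ∈ greedy (freeTimes A r e a) (r a) (e a) →
      t ∉ greedy (freeTimes A r e b) (r b) (e b) := fun a b hab ha hb =>
    (freeTimes_anti (Nat.succ_le_of_lt hab) hb.1).2 ha
  rcases lt_trichotomy i j with h | h | h
  · exact absurd hj (key _ _ h hi)
  · exact h
  · exact absurd hi (key _ _ h hj)

/-- A time that the first `j` jobs leave free after their releases separates their executions from
all later times. -/
theorem mem_freeTimes_of_le {t u : ℝ} {j : ℕ} (ht0 : 0 ≤ t) (ht : t ∈ freeTimes A r e j)
    (hr : ∀ i < j, r i ≤ ENNReal.ofReal t) (htu : t ≤ u) (hu : u ∈ A) :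
    u ∈ freeTimes A r e j := by
  induction j with
  | zero => exact hu
  | succ j ih =>
    -- If job `j` ran at `u`, it would be unfinished at the earlier time `t`, and being greedy it
    -- would have taken `t`.
    refine ⟨ih ht.1 fun i hi => hr i (hi.trans (Nat.lt_succ_self j)), fun hg => ht.2 ?_⟩
    exact ⟨ht.1, ht0, hr j (Nat.lt_succ_self j),
      (measureReal_inter_Ico_mono _ _ htu).trans_lt hg.2.2.2⟩

/-- If `A` misses at most `K` time units, releases are at least `T` apart and no job needs more
than `T`, then what the first `j` jobs occupy after the release of job `j`, together with the times
outside `A`, amounts to at most `K`. -/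
theorem le_measureReal_freeTimes {K T : ℝ} (hT : 0 ≤ T)
    (hA : ∀ s x, 0 ≤ s → x - s - K ≤ volume.real (A ∩ Ico s x))
    (hr : ∀ j, r j + ENNReal.ofReal T ≤ r (j + 1)) (he : ∀ j, 0 < e j ∧ e j ≤ T) (j : ℕ)
    (hj : r j ≠ ⊤) (x : ℝ) :
    x - (r j).toReal - K ≤ volume.real (freeTimes A r e j ∩ Ico (r j).toReal x) := by
  induction j generalizing x with
  | zero => exact hA _ _ ENNReal.toReal_nonneg
  | succ j ih =>
    have hmono : Monotone r := monotone_nat_of_le_succ fun i => le_self_add.trans (hr i)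
    have hj' : r j ≠ ⊤ := ne_top_of_le_ne_top hj (hmono (Nat.le_succ j))
    have hstep : (r j).toReal + T ≤ (r (j + 1)).toReal := by
      have := ENNReal.toReal_mono hj (hr j)
      rwa [ENNReal.toReal_add hj' ENNReal.ofReal_ne_top, ENNReal.toReal_ofReal hT] at this
    have hr0 : 0 ≤ (r j).toReal := ENNReal.toReal_nonneg
    -- If some time between the two releases is left free, all earlier jobs are finished by then,
    -- and only the loss `K` of `A` itself counts.
    by_cases hfree : ∃ t ∈ freeTimes A r e (j + 1), (r j).toReal ≤ t ∧ t < (r (j + 1)).toReal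
    · obtain ⟨t, ht, h1, h2⟩ := hfree
      have ht0 : 0 ≤ t := hr0.trans h1
      refine (hA _ x ENNReal.toReal_nonneg).trans (measureReal_mono ?_
        (ne_top_of_le_ne_top (by simp) (measure_mono inter_subset_right)))
      rintro u ⟨hu, h3, h4⟩
      refine ⟨mem_freeTimes_of_le ht0 ht (fun i hi => ?_) (h2.le.trans h3) hu, h3, h4⟩
      exact (hmono (Nat.le_of_lt_succ hi)).trans ((ENNReal.le_ofReal_iff_toReal_le hj' ht0).2 h1)
    -- Otherwise nothing is free between the releases. Job `j` adds at most `T` to the occupied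
    -- time, and the window starts at least `T` later.
    · push Not at hfree
      have h1 := measureReal_inter_Ico_sub_le (A := freeTimes A r e j)
        (A' := freeTimes A r e (j + 1)) (V := greedy (freeTimes A r e j) (r j) (e j)) (x := x)
        subset_rfl hr0 (measureReal_greedy_le (he j).1 x)
      have h2 : freeTimes A r e (j + 1) ∩ Ico (r j).toReal x ⊆
          freeTimes A r e (j + 1) ∩ Ico (r (j + 1)).toReal x := fun u hu =>
        ⟨hu.1, hfree u hu.1 hu.2.1, hu.2.2⟩
      have h3 := measureReal_mono (μ := volume) h2
        (ne_top_of_le_ne_top (by simp) (measure_mono inter_subset_right))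
      have := ih hj' x
      have := (he j).2
      linarith

end FreeTimes

/-! ### The three kinds of tasks. -/

/-- The periodic task assigned to processor `m`. -/
def periodicTask {M : ℕ} (m : Fin M) : Fin (2 * M + 1) := ⟨m.val, by omega⟩

/-- The one-shot task assigned to processor `m`. -/
def oneShotTask {M : ℕ} (m : Fin M) : Fin (2 * M + 1) := ⟨M + m.val, by omega⟩

theorem task_cases {M : ℕ} (i : Fin (2 * M + 1)) :
    (∃ m : Fin M, i = periodicTask m) ∨ (∃ m : Fin M, i = oneShotTask m) ∨
      i = Fin.last (2 * M) := by
  rcases lt_or_ge i.val M with h | h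
  · exact Or.inl ⟨⟨i.val, h⟩, rfl⟩
  · rcases lt_or_ge i.val (2 * M) with h' | h'
    · refine Or.inr (Or.inl ⟨⟨i.val - M, by omega⟩, Fin.ext ?_⟩)
      simp only [oneShotTask]
      omega
    · exact Or.inr (Or.inr (Fin.ext (by simp only [Fin.val_last]; omega)))

theorem periodicTask_inj {M : ℕ} {m m' : Fin M} : periodicTask m = periodicTask m' ↔ m = m' := by
  simp [periodicTask, Fin.ext_iff]

theorem oneShotTask_inj {M : ℕ} {m m' : Fin M} : oneShotTask m = oneShotTask m' ↔ m = m' := by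
  simp [oneShotTask, Fin.ext_iff]

theorem periodicTask_ne_oneShotTask {M : ℕ} (m m' : Fin M) :
    periodicTask m ≠ oneShotTask m' := by
  simp only [periodicTask, oneShotTask, ne_eq, Fin.ext_iff]
  omega

theorem periodicTask_ne_last {M : ℕ} (m : Fin M) : periodicTask m ≠ Fin.last (2 * M) := by
  simp only [periodicTask, ne_eq, Fin.ext_iff, Fin.val_last]
  omega

theorem oneShotTask_ne_last {M : ℕ} (m : Fin M) : oneShotTask m ≠ Fin.last (2 * M) := by
  simp only [oneShotTask, ne_eq, Fin.ext_iff, Fin.val_last]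
  omega

theorem adTasks_periodicTask {M : ℕ} (ε η : ℝ) (m : Fin M) :
    adTasks M ε η (periodicTask m) = { C := ε / 3, D := 1, T := ENNReal.ofReal ε } := by
  simp [adTasks, periodicTask]

theorem adTasks_oneShotTask {M : ℕ} (ε η : ℝ) (m : Fin M) :
    adTasks M ε η (oneShotTask m) = { C := 1 / 3, D := 1 + η, T := ⊤ } := by
  have h1 : ¬ M + m.val < M := by omega
  have h2 : M + m.val < 2 * M := by omega
  simp [adTasks, oneShotTask, h2]

theorem adTasks_last {M : ℕ} (ε η : ℝ) :
    adTasks M ε η (Fin.last (2 * M)) = { C := (1 + ε) / 3, D := 1 + 2 * η, T := ⊤ } := by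
  have h1 : ¬ 2 * M < M := by omega
  simp [adTasks, h1]

theorem adSplit_last {M : ℕ} (τ : Fin (2 * M + 1) → Task) (m : Fin M) :
    adSplit M τ (Fin.last (2 * M)) m = (τ (Fin.last (2 * M))).C / M := by
  simp [adSplit]

theorem adSplit_periodicTask {M : ℕ} (τ : Fin (2 * M + 1) → Task) (m m' : Fin M) :
    adSplit M τ (periodicTask m) m' = if m' = m then (τ (periodicTask m)).C else 0 := by
  have h : ((periodicTask m).val = m'.val ∨ (periodicTask m).val = M + m'.val) ↔ m' = m := by
    simp only [periodicTask, Fin.ext_iff]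
    omega
  simp only [adSplit, if_neg (periodicTask_ne_last m), h]

theorem adSplit_oneShotTask {M : ℕ} (τ : Fin (2 * M + 1) → Task) (m m' : Fin M) :
    adSplit M τ (oneShotTask m) m' = if m' = m then (τ (oneShotTask m)).C else 0 := by
  have h : ((oneShotTask m).val = m'.val ∨ (oneShotTask m).val = M + m'.val) ↔ m' = m := by
    simp only [oneShotTask, Fin.ext_iff]
    omega
  simp only [adSplit, if_neg (oneShotTask_ne_last m), h]

/-! ### Schedules built from prescribed sets of execution times. -/

/-- The semi-partitioned assignment in which processor `m` executes job `j` of its periodic task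
during `V m j`, its one-shot task during `U m` and the last task during `B m`. -/
def assignment {M : ℕ} (V : Fin M → ℕ → Set ℝ) (U B : Fin M → Set ℝ) (m : Fin M)
    (i : Fin (2 * M + 1)) (j : ℕ) : Set ℝ :=
  {t | (i = periodicTask m ∧ t ∈ V m j) ∨ (i = oneShotTask m ∧ j = 0 ∧ t ∈ U m) ∨
    (i = Fin.last (2 * M) ∧ j = 0 ∧ t ∈ B m)}

section Assignment

variable {M : ℕ} (V : Fin M → ℕ → Set ℝ) (U B : Fin M → Set ℝ)

theorem assignment_periodicTask (m m' : Fin M) (j : ℕ) :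
    assignment V U B m (periodicTask m') j = if m = m' then V m' j else ∅ := by
  ext t
  split_ifs with h
  · simp [assignment, periodicTask_ne_oneShotTask, periodicTask_ne_last, h]
  · simp [assignment, periodicTask_ne_oneShotTask, periodicTask_ne_last, periodicTask_inj,
      Ne.symm h]

theorem assignment_oneShotTask (m m' : Fin M) (j : ℕ) :
    assignment V U B m (oneShotTask m') j = if m = m' ∧ j = 0 then U m' else ∅ := by
  ext t
  split_ifs with h
  · simp [assignment, (periodicTask_ne_oneShotTask _ _).symm, oneShotTask_ne_last, h.1, h.2]
  · simp only [assignment, (periodicTask_ne_oneShotTask _ _).symm, oneShotTask_ne_last,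
      oneShotTask_inj, mem_ofPred_eq, false_and, false_or, or_false, mem_empty_iff_false, iff_false]
    exact fun h' => h ⟨h'.1.symm, h'.2.1⟩

theorem assignment_last (m : Fin M) (j : ℕ) :
    assignment V U B m (Fin.last (2 * M)) j = if j = 0 then B m else ∅ := by
  ext t
  split_ifs with h
  · simp [assignment, (periodicTask_ne_last _).symm, (oneShotTask_ne_last _).symm, h]
  · simp [assignment, (periodicTask_ne_last _).symm, (oneShotTask_ne_last _).symm, h]

variable {V U B}

theorem exists_schedule_assignment (hV : ∀ m j, MeasurableSet (V m j))
    (hU : ∀ m, MeasurableSet (U m)) (hB : ∀ m, MeasurableSet (B m))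
    (hVV : ∀ m t j j', t ∈ V m j → t ∈ V m j' → j = j')
    (hVU : ∀ m t j, t ∈ V m j → t ∉ U m) (hVB : ∀ m t j, t ∈ V m j → t ∉ B m)
    (hUB : ∀ m t, t ∈ U m → t ∉ B m) :
    ∃ S : Schedule M (2 * M + 1), ∀ m i j t, S.run m t = some (i, j) ↔
      t ∈ assignment V U B m i j := by
  refine exists_schedule _ (fun m i j => ?_) ?_
  · rcases task_cases i with ⟨m', rfl⟩ | ⟨m', rfl⟩ | rfl
    · rw [assignment_periodicTask]
      split_ifs
      exacts [hV _ _, MeasurableSet.empty]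
    · rw [assignment_oneShotTask]
      split_ifs
      exacts [hU _, MeasurableSet.empty]
    · rw [assignment_last]
      split_ifs
      exacts [hB _, MeasurableSet.empty]
  · rintro m t i j i' j' (⟨rfl, h⟩ | ⟨rfl, rfl, h⟩ | ⟨rfl, rfl, h⟩)
      (⟨rfl, h'⟩ | ⟨rfl, rfl, h'⟩ | ⟨rfl, rfl, h'⟩)
    · exact ⟨rfl, hVV m t j j' h h'⟩
    · exact absurd h' (hVU _ _ _ h)
    · exact absurd h' (hVB _ _ _ h)
    · exact absurd h (hVU _ _ _ h')
    · exact ⟨rfl, rfl⟩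
    · exact absurd h' (hUB _ _ h)
    · exact absurd h (hVB _ _ _ h')
    · exact absurd h (hUB _ _ h')
    · exact ⟨rfl, rfl⟩

variable {S : Schedule M (2 * M + 1)}

theorem serviceOn_periodicTask
    (hS : ∀ m i j t, S.run m t = some (i, j) ↔ t ∈ assignment V U B m i j)
    (m m' : Fin M) (j : ℕ) (t : ℝ) :
    S.serviceOn m (periodicTask m') j t =
      if m = m' then volume.real (V m' j ∩ Ico 0 t) else 0 := by
  rw [serviceOn_eq hS, assignment_periodicTask]
  split_ifs <;> simp

theorem serviceOn_oneShotTask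
    (hS : ∀ m i j t, S.run m t = some (i, j) ↔ t ∈ assignment V U B m i j)
    (m m' : Fin M) (j : ℕ) (t : ℝ) :
    S.serviceOn m (oneShotTask m') j t =
      if m = m' ∧ j = 0 then volume.real (U m' ∩ Ico 0 t) else 0 := by
  rw [serviceOn_eq hS, assignment_oneShotTask]
  split_ifs <;> simp

theorem serviceOn_last
    (hS : ∀ m i j t, S.run m t = some (i, j) ↔ t ∈ assignment V U B m i j)
    (m : Fin M) (j : ℕ) (t : ℝ) :
    S.serviceOn m (Fin.last (2 * M)) j t =
      if j = 0 then volume.real (B m ∩ Ico 0 t) else 0 := by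
  rw [serviceOn_eq hS, assignment_last]
  split_ifs <;> simp

theorem service_periodicTask
    (hS : ∀ m i j t, S.run m t = some (i, j) ↔ t ∈ assignment V U B m i j)
    (m : Fin M) (j : ℕ) (t : ℝ) :
    S.service (periodicTask m) j t = volume.real (V m j ∩ Ico 0 t) := by
  simp [Schedule.service, serviceOn_periodicTask hS]

theorem service_oneShotTask
    (hS : ∀ m i j t, S.run m t = some (i, j) ↔ t ∈ assignment V U B m i j)
    (m : Fin M) (t : ℝ) :
    S.service (oneShotTask m) 0 t = volume.real (U m ∩ Ico 0 t) := by
  simp [Schedule.service, serviceOn_oneShotTask hS]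

theorem service_last
    (hS : ∀ m i j t, S.run m t = some (i, j) ↔ t ∈ assignment V U B m i j)
    (t : ℝ) :
    S.service (Fin.last (2 * M)) 0 t = ∑ m, volume.real (B m ∩ Ico 0 t) := by
  simp [Schedule.service, serviceOn_last hS]

/-- Parallel execution must be excluded only for the last task (`hBB`), since every other task is
bound to one processor. -/
theorem isScheduleOf_assignment {J : Jobs (2 * M + 1)}
    (hS : ∀ m i j t, S.run m t = some (i, j) ↔ t ∈ assignment V U B m i j)
    (hV : ∀ m t j, 0 ≤ t → t ∈ V m j → J.release (periodicTask m) j ≤ ENNReal.ofReal t ∧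
      volume.real (V m j ∩ Ico 0 t) < J.exec (periodicTask m) j)
    (hU : ∀ m t, 0 ≤ t → t ∈ U m → J.release (oneShotTask m) 0 ≤ ENNReal.ofReal t ∧
      volume.real (U m ∩ Ico 0 t) < J.exec (oneShotTask m) 0)
    (hB : ∀ m t, 0 ≤ t → t ∈ B m → J.release (Fin.last (2 * M)) 0 ≤ ENNReal.ofReal t ∧
      ∑ m, volume.real (B m ∩ Ico 0 t) < J.exec (Fin.last (2 * M)) 0)
    (hBB : ∀ m m' t, t ∈ B m → t ∈ B m' → m = m') : S.IsScheduleOf J := by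
  constructor
  · intro t ht m i j h
    rw [hS] at h
    rcases h with ⟨rfl, h⟩ | ⟨rfl, rfl, h⟩ | ⟨rfl, rfl, h⟩
    · exact ⟨(hV m t j ht h).1, by rw [service_periodicTask hS]; exact (hV m t j ht h).2⟩
    · exact ⟨(hU m t ht h).1, by rw [service_oneShotTask hS]; exact (hU m t ht h).2⟩
    · exact ⟨(hB m t ht h).1, by rw [service_last hS]; exact (hB m t ht h).2⟩
  · intro t ht m m' i j j' h h'
    rw [hS] at h h'
    rcases h with ⟨rfl, h⟩ | ⟨rfl, rfl, h⟩ | ⟨rfl, rfl, h⟩ <;>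
      rcases h' with ⟨e, h'⟩ | ⟨e, rfl, h'⟩ | ⟨e, rfl, h'⟩
    · exact periodicTask_inj.1 e
    · exact absurd e (periodicTask_ne_oneShotTask _ _)
    · exact absurd e (periodicTask_ne_last _)
    · exact absurd e.symm (periodicTask_ne_oneShotTask _ _)
    · exact oneShotTask_inj.1 e
    · exact absurd e (oneShotTask_ne_last _)
    · exact absurd e.symm (periodicTask_ne_last _)
    · exact absurd e.symm (oneShotTask_ne_last _)
    · exact hBB m m' t h h'

end Assignment

theorem release_eq_top_of_T_eq_top {N : ℕ} {τ : Fin N → Task} {J : Jobs N} (hJ : J.Legal τ)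
    {i : Fin N} (hi : (τ i).T = ⊤) (j : ℕ) : J.release i (j + 1) = ⊤ := by
  have := hJ.1 i j
  rwa [hi, add_top, top_le_iff] at this

/-! ### Feasibility at low speed by semi-partitioning. -/

/-- The `m`-th of consecutive time slots of length `d`, starting at time `r`. -/
def slot (r : ℝ≥0∞) (d : ℝ) (m : ℕ) : Set ℝ :=
  -- Otherwise `⊤.toReal = 0` would let a job that is never released run from time 0.
  if r = ⊤ then ∅ else Ico (r.toReal + m * d) (r.toReal + (m + 1) * d)

theorem measurableSet_slot (r : ℝ≥0∞) (d : ℝ) (m : ℕ) : MeasurableSet (slot r d m) := by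
  unfold slot
  split_ifs
  exacts [MeasurableSet.empty, measurableSet_Ico]

theorem eq_of_mem_slot {r : ℝ≥0∞} {d : ℝ} (hd : 0 < d) {m m' : ℕ} {t : ℝ} (h : t ∈ slot r d m)
    (h' : t ∈ slot r d m') : m = m' := by
  unfold slot at h h'
  split_ifs at h h' with hr
  · exact h.elim
  · have h1 : (m : ℝ) * d < (m' + 1) * d := by linarith [h.1, h'.2]
    have h2 : (m' : ℝ) * d < (m + 1) * d := by linarith [h'.1, h.2]
    have h3 := lt_of_mul_lt_mul_right h1 hd.le
    have h4 := lt_of_mul_lt_mul_right h2 hd.le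
    norm_cast at h3 h4
    omega

theorem measureReal_slot_inter_le {d : ℝ} (hd : 0 < d) (r : ℝ≥0∞) (m : ℕ) (t : ℝ) :
    volume.real (slot r d m ∩ Ico 0 t) ≤ d := by
  unfold slot
  split_ifs
  · simp [hd.le]
  · refine (measureReal_mono inter_subset_left (by simp)).trans ?_
    rw [Real.volume_real_Ico_of_le (by nlinarith)]
    linarith

theorem measureReal_slot_inter_lt {d : ℝ} {r : ℝ≥0∞} {m : ℕ} {t : ℝ}
    (ht : t ∈ slot r d m) : volume.real (slot r d m ∩ Ico 0 t) < d := by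
  unfold slot at *
  split_ifs at * with hr
  · exact ht.elim
  · obtain ⟨h1, h2⟩ := ht
    have : Ico (r.toReal + m * d) (r.toReal + (m + 1) * d) ∩ Ico 0 t ⊆ Ico (r.toReal + m * d) t :=
      fun u hu => ⟨hu.1.1, hu.2.2⟩
    refine (measureReal_mono this (by simp)).trans_lt ?_
    rw [Real.volume_real_Ico_of_le h1]
    linarith

theorem le_ofReal_of_mem_slot {d : ℝ} (hd : 0 < d) {r : ℝ≥0∞} {m : ℕ} {t : ℝ}
    (ht : t ∈ slot r d m) : r ≤ ENNReal.ofReal t := by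
  unfold slot at ht
  split_ifs at ht with hr
  · exact ht.elim
  · have h1 : r.toReal ≤ t := by
      have : 0 ≤ (m : ℝ) * d := by positivity
      linarith [ht.1]
    exact (ENNReal.le_ofReal_iff_toReal_le hr (ENNReal.toReal_nonneg.trans h1)).2 h1

theorem measureReal_slot_inter {d : ℝ} (hd : 0 < d) {r : ℝ≥0∞} (hr : r ≠ ⊤) {m : ℕ} {t : ℝ}
    (ht : r.toReal + (m + 1) * d ≤ t) : volume.real (slot r d m ∩ Ico 0 t) = d := by
  have h0 : 0 ≤ r.toReal + m * d := by positivity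
  rw [slot, if_neg hr, inter_eq_left.2 (Ico_subset_Ico h0 ht),
    Real.volume_real_Ico_of_le (by nlinarith)]
  ring

theorem measureReal_Ici_inter_Ico {s x : ℝ} (hs : 0 ≤ s) :
    x - s ≤ volume.real (Ici (0 : ℝ) ∩ Ico s x) := by
  have h : Ico s x ⊆ Ici 0 := fun u hu => hs.trans hu.1
  rw [inter_eq_right.2 h, Real.volume_real_Ico]
  exact le_max_left _ _

/-- On each processor the slot of the last task comes first, the one-shot job next, and the periodic
jobs take what is left. -/
theorem semiPartitionedFeasible_adTasks {M : ℕ} (hM : 0 < M) {ε η v : ℝ} (hε : 0 < ε) (hη : 0 < η)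
    (hv : (1 + ε) / 3 + (1 + ε) / (3 * (M : ℝ)) ≤ v) :
    SemiPartitionedFeasible M (atSpeed v (adTasks M ε η))
      (adSplit M (atSpeed v (adTasks M ε η))) := by
  have hM0 : (0 : ℝ) < M := by exact_mod_cast hM
  have hv3 : (1 + ε) / 3 < v := by
    have : 0 < (1 + ε) / (3 * (M : ℝ)) := by positivity
    linarith
  have hv0 : 0 < v := by linarith
  set τ := atSpeed v (adTasks M ε η) with hτ
  set last := Fin.last (2 * M) with hlast
  have hτp : ∀ m : Fin M, τ (periodicTask m) = ⟨ε / 3 / v, 1, ENNReal.ofReal ε⟩ := fun m => by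
    simp [hτ, atSpeed, adTasks_periodicTask]
  have hτo : ∀ m : Fin M, τ (oneShotTask m) = ⟨1 / 3 / v, 1 + η, ⊤⟩ := fun m => by
    simp [hτ, atSpeed, adTasks_oneShotTask]
  have hτl : τ last = ⟨(1 + ε) / 3 / v, 1 + 2 * η, ⊤⟩ := by
    simp [hτ, hlast, atSpeed, adTasks_last]
  have hC : ∀ i, 0 ≤ (τ i).C := by
    intro i
    rcases task_cases i with ⟨m, rfl⟩ | ⟨m, rfl⟩ | rfl
    · rw [hτp]; positivity
    · rw [hτo]; positivity
    · rw [← hlast, hτl]; positivity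
  -- The load of one processor within a window of length 1; this is the hypothesis on `v` divided by
  -- `v`.
  have hload : ε / 3 / v + 1 / 3 / v + (1 + ε) / 3 / v / M ≤ 1 := by
    have : ε / 3 / v + 1 / 3 / v + (1 + ε) / 3 / v / M =
        ((1 + ε) / 3 + (1 + ε) / (3 * (M : ℝ))) / v := by
      field_simp
      ring
    rw [this]
    exact (div_le_one hv0).2 hv
  have hlast_le : (1 + ε) / 3 / v ≤ 1 := (div_le_one hv0).2 hv3.le
  have hper_le : ε / 3 / v ≤ ε := by
    rw [div_le_iff₀ hv0]
    nlinarith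
  have hb0 : ∀ i m, 0 ≤ adSplit M τ i m := by
    intro i m
    rcases task_cases i with ⟨m', rfl⟩ | ⟨m', rfl⟩ | rfl
    · rw [adSplit_periodicTask]
      split_ifs
      exacts [hC _, le_rfl]
    · rw [adSplit_oneShotTask]
      split_ifs
      exacts [hC _, le_rfl]
    · rw [adSplit_last]
      exact div_nonneg (hC _) hM0.le
  refine ⟨hb0, fun i => ?_, fun J hJ => ?_⟩
  · rcases task_cases i with ⟨m', rfl⟩ | ⟨m', rfl⟩ | rfl
    · simp [adSplit_periodicTask]
    · simp [adSplit_oneShotTask]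
    · simp only [adSplit_last, Finset.sum_const, Finset.card_univ, Fintype.card_fin, nsmul_eq_mul]
      field_simp
  have hpos : ∀ i j, 0 < J.exec i j := fun i j => (hJ.2 i j).1
  have hep : ∀ m j, J.exec (periodicTask m) j ≤ ε / 3 / v := fun m j => by
    simpa [hτp] using (hJ.2 (periodicTask m) j).2
  have heo : ∀ m j, J.exec (oneShotTask m) j ≤ 1 / 3 / v := fun m j => by
    simpa [hτo] using (hJ.2 (oneShotTask m) j).2
  have hel : ∀ j, J.exec last j ≤ (1 + ε) / 3 / v := fun j => by
    simpa [hτl] using (hJ.2 last j).2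
  -- The actual demand is split, not the worst case, because a finished job must not be executed.
  set d := J.exec last 0 / M with hd
  have hd0 : 0 < d := div_pos (hpos _ _) hM0
  have hMd : M * d = J.exec last 0 := by rw [hd]; field_simp
  have hdle : d ≤ (1 + ε) / 3 / v / M := by rw [hd]; gcongr; exact hel 0
  let B : Fin M → Set ℝ := fun m => slot (J.release last 0) d m
  let U : Fin M → Set ℝ := fun m =>
    greedy (Ici 0 \ B m) (J.release (oneShotTask m) 0) (J.exec (oneShotTask m) 0)
  let F : Fin M → ℕ → Set ℝ := fun m =>
    freeTimes ((Ici 0 \ B m) \ U m) (J.release (periodicTask m)) (J.exec (periodicTask m))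
  let V : Fin M → ℕ → Set ℝ := fun m j =>
    greedy (F m j) (J.release (periodicTask m) j) (J.exec (periodicTask m) j)
  have hBm : ∀ m, MeasurableSet (B m) := fun m => measurableSet_slot _ _ _
  have hBfree : ∀ m, MeasurableSet (Ici 0 \ B m) := fun m => measurableSet_Ici.diff (hBm m)
  have hUm : ∀ m, MeasurableSet (U m) := fun m => measurableSet_greedy (hBfree m) _ _
  have hVm : ∀ m j, MeasurableSet (V m j) := fun m j =>
    measurableSet_greedy (measurableSet_freeTimes ((hBfree m).diff (hUm m)) j) _ _
  have hVfree : ∀ m j, V m j ⊆ (Ici 0 \ B m) \ U m := fun m j =>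
    (greedy_subset _ _ _).trans (freeTimes_anti (Nat.zero_le j))
  have hUfree : ∀ m, U m ⊆ Ici 0 \ B m := fun m => greedy_subset _ _ _
  obtain ⟨S, hS⟩ := exists_schedule_assignment (V := V) (U := U) (B := B) hVm hUm hBm
    (fun m t j j' h h' => eq_of_mem_greedy_freeTimes h h')
    (fun m t j h => (hVfree m j h).2) (fun m t j h => (hVfree m j h).1.2)
    (fun m t h => (hUfree m h).2)
  have hBload : ∀ (m : Fin M) (s x : ℝ), 0 ≤ s →
      x - s - d ≤ volume.real ((Ici 0 \ B m) ∩ Ico s x) := by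
    intro m s x hs
    have h1 := measureReal_Ici_inter_Ico (x := x) hs
    have h2 := measureReal_inter_Ico_sub_le (A := Ici 0) (V := B m) (x := x) subset_rfl hs
      (measureReal_slot_inter_le hd0 _ _ _)
    linarith
  have hUload : ∀ (m : Fin M) (s x : ℝ), 0 ≤ s → x - s - (d + J.exec (oneShotTask m) 0) ≤
      volume.real (((Ici 0 \ B m) \ U m) ∩ Ico s x) := by
    intro m s x hs
    have h1 := hBload m s x hs
    have h2 := measureReal_inter_Ico_sub_le (A := Ici 0 \ B m) (V := U m) (x := x) subset_rfl hs
      (measureReal_greedy_le (hpos _ _) _)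
    linarith
  refine ⟨S, ?_, ?_, ?_⟩
  · refine isScheduleOf_assignment hS
      (fun m t j _ h => ⟨h.2.2.1, measureReal_greedy_lt (hpos _ _) h⟩)
      (fun m t _ h => ⟨h.2.2.1, measureReal_greedy_lt (hpos _ _) h⟩)
      (fun m t _ h => ⟨le_ofReal_of_mem_slot hd0 h, ?_⟩)
      (fun m m' t h h' => Fin.ext (eq_of_mem_slot hd0 h h'))
    -- The slot that contains `t` is incomplete and every other slot contributes at most `d`, so the
    -- job is unfinished.
    calc ∑ m, volume.real (B m ∩ Ico 0 t) < ∑ _m : Fin M, d :=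
          Finset.sum_lt_sum (fun m' _ => measureReal_slot_inter_le hd0 _ _ _)
            ⟨m, Finset.mem_univ m, measureReal_slot_inter_lt h⟩
      _ = J.exec last 0 := by simp [hMd]
  · intro i j hr
    rcases task_cases i with ⟨m, rfl⟩ | ⟨m, rfl⟩ | rfl
    · rw [service_periodicTask hS, hτp]
      simp only [V]
      rw [measureReal_greedy_inter hr (hpos _ _), le_min_iff]
      refine ⟨?_, le_rfl⟩
      -- `K` is the total loss to the slot and the one-shot job; by `hload` the window of length 1
      -- still has room for the periodic job.
      have := le_measureReal_freeTimes (K := d + J.exec (oneShotTask m) 0) hε.le (hUload m)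
        (fun j => by simpa [hτp] using hJ.1 (periodicTask m) j)
        (fun j => ⟨hpos _ j, (hep m j).trans hper_le⟩) j hr
        ((J.release (periodicTask m) j).toReal + 1)
      have h1 := hep m j
      have h2 := heo m 0
      linarith
    · cases j with
      | succ j => exact absurd (release_eq_top_of_T_eq_top hJ (by simp [hτo]) j) hr
      | zero =>
        rw [service_oneShotTask hS, hτo]
        simp only [U]
        rw [measureReal_greedy_inter hr (hpos _ _), le_min_iff]
        refine ⟨?_, le_rfl⟩
        have h1 := hBload m _ ((J.release (oneShotTask m) 0).toReal + (1 + η))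
          (ENNReal.toReal_nonneg (a := J.release (oneShotTask m) 0))
        have h2 := heo m 0
        have h3 : 0 < ε / 3 / v := by positivity
        linarith
    · cases j with
      | succ j => exact absurd (release_eq_top_of_T_eq_top hJ (by simp [← hlast, hτl]) j) hr
      | zero =>
        rw [service_last hS, ← hlast, hτl, ← hMd]
        refine le_of_eq ?_
        calc (M : ℝ) * d = ∑ _m : Fin M, d := by simp
          _ = _ := Finset.sum_congr rfl fun m _ => (measureReal_slot_inter hd0 hr ?_).symm
        -- Even the last slot ends at most `M * d ≤ 1` after the release.
        have h1 : ((m : ℕ) : ℝ) + 1 ≤ M := by exact_mod_cast m.isLt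
        have h2 := hel 0
        have h3 : (((m : ℕ) : ℝ) + 1) * d ≤ M * d := by gcongr
        simp only
        linarith
  · intro i j m t
    rcases task_cases i with ⟨m', rfl⟩ | ⟨m', rfl⟩ | rfl
    · rw [serviceOn_periodicTask hS, adSplit_periodicTask, hτp]
      split_ifs
      · exact (measureReal_greedy_le (hpos _ _) _).trans (hep _ _)
      · exact le_rfl
    · rw [serviceOn_oneShotTask hS]
      split_ifs with h
      · rw [adSplit_oneShotTask, if_pos h.1, hτo]
        exact (measureReal_greedy_le (hpos _ _) _).trans (heo _ _)
      · exact hb0 _ _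
    · rw [serviceOn_last hS]
      split_ifs with h
      · rw [adSplit_last, ← hlast, hτl]
        exact (measureReal_slot_inter_le hd0 _ _ _).trans hdle
      · exact hb0 _ _

/-! ### The deadline miss of global DM at speed 1. -/

theorem ncard_range_lt {M : ℕ} {f : Fin M → Fin (2 * M + 1)} {s : Set (Fin (2 * M + 1))} (m : Fin M)
    (hs : s ⊆ range f) (hm : f m ∉ s) : s.ncard < M := by
  have h : s ⊂ range f := ⟨hs, fun h => hm (h ⟨m, rfl⟩)⟩
  refine (ncard_lt_ncard h (toFinite _)).trans_le ?_
  rw [← image_univ]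
  exact (ncard_image_le (toFinite _)).trans (by simp)

/-- A whole group of `M` active tasks of higher priority blocks a task; `ncard_range_lt` is the
converse count, when only other members of the task's own group compete. -/
theorem le_ncard_of_range_subset {M : ℕ} {f : Fin M → Fin (2 * M + 1)} (hf : Function.Injective f)
    {s : Set (Fin (2 * M + 1))} (hs : range f ⊆ s) : M ≤ s.ncard := by
  refine le_trans ?_ (ncard_le_ncard hs (toFinite _))
  rw [← image_univ, ncard_image_of_injective _ hf]
  simp

theorem measureReal_Ico_inter_lt_iff {a c t : ℝ} (ha : 0 ≤ a) (hc : 0 < c) :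
    volume.real (Ico a (a + c) ∩ Ico 0 t) < c ↔ t < a + c := by
  rw [Ico_inter_Ico, Real.volume_real_Ico, max_eq_left ha, max_lt_iff, sub_lt_iff_lt_add',
    min_lt_iff]
  simp [hc]

/-- Priorities within a group are irrelevant: its `M` tasks run simultaneously, one per processor.
Hence every way of breaking ties yields the same execution times. -/
theorem exists_isGlobalFP_adTasks {M n : ℕ} (hM : 0 < M) (hn : 0 < n) {ε η : ℝ}
    (hε : ε = 1 / (n : ℝ)) (hη : 0 < η) (hη' : η < ε / 6) (prio : Equiv.Perm (Fin (2 * M + 1)))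
    (hprio : IsDM (adTasks M ε η) prio) :
    ∃ S : Schedule M (2 * M + 1), S.IsGlobalFP (synchronous (adTasks M ε η)) prio ∧
      ¬ S.MeetsDeadline (adTasks M ε η) (synchronous (adTasks M ε η)) (Fin.last (2 * M)) 0 := by
  have hn0 : (0 : ℝ) < n := by exact_mod_cast hn
  have hε0 : 0 < ε := by rw [hε]; positivity
  have hnε : n * ε = 1 := by rw [hε]; field_simp
  set J := synchronous (adTasks M ε η) with hJ
  set last := Fin.last (2 * M) with hlast
  have hrp : ∀ (m : Fin M) (j : ℕ), J.release (periodicTask m) j = ENNReal.ofReal (j * ε) :=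
    fun m j => by
      simp only [hJ, synchronous, adTasks_periodicTask]
      rw [ENNReal.ofReal_mul (by positivity), ENNReal.ofReal_natCast]
  have hep : ∀ (m : Fin M) (j : ℕ), J.exec (periodicTask m) j = ε / 3 := fun m j => by
    simp [hJ, synchronous, adTasks_periodicTask]
  have hro : ∀ m : Fin M, J.release (oneShotTask m) 0 = 0 := fun m => by simp [hJ, synchronous]
  have hro' : ∀ (m : Fin M) (j : ℕ), J.release (oneShotTask m) (j + 1) = ⊤ := fun m j => by
    simp [hJ, synchronous, adTasks_oneShotTask, ENNReal.mul_top]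
  have heo : ∀ (m : Fin M) (j : ℕ), J.exec (oneShotTask m) j = 1 / 3 := fun m j => by
    simp [hJ, synchronous, adTasks_oneShotTask]
  have hrl : J.release last 0 = 0 := by simp [hJ, synchronous]
  have hrl' : ∀ j : ℕ, J.release last (j + 1) = ⊤ := fun j => by
    simp [hJ, hlast, synchronous, adTasks_last, ENNReal.mul_top]
  have hel : ∀ j : ℕ, J.exec last j = (1 + ε) / 3 := fun j => by
    simp [hJ, hlast, synchronous, adTasks_last]
  have he3 : 0 < (1 + ε) / 3 := by positivity
  let P : ℕ → Set ℝ := fun j => Ico (j * ε) (j * ε + ε / 3)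
  let A : Set ℝ := Ici 0 \ ⋃ j, P j
  let U : Set ℝ := greedy A 0 (1 / 3)
  let L : Set ℝ := greedy (A \ U) 0 ((1 + ε) / 3)
  -- While the last task runs, no task of higher priority is active; the choice of processor 0 is
  -- arbitrary.
  let B : Fin M → Set ℝ := fun m => if m = ⟨0, hM⟩ then L else ∅
  have hPm : ∀ j, MeasurableSet (P j) := fun j => measurableSet_Ico
  have hAm : MeasurableSet A := measurableSet_Ici.diff (MeasurableSet.iUnion hPm)
  have hUm : MeasurableSet U := measurableSet_greedy hAm _ _
  have hLm : MeasurableSet L := measurableSet_greedy (hAm.diff hUm) _ _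
  have hBm : ∀ m, MeasurableSet (B m) := fun m => by
    simp only [B]
    split_ifs
    exacts [hLm, MeasurableSet.empty]
  have hBL : ∀ m, B m ⊆ L := fun m => by
    simp only [B]
    split_ifs
    exacts [subset_rfl, empty_subset _]
  have hPP : ∀ t j j', t ∈ P j → t ∈ P j' → j = j' := by
    intro t j j' h h'
    have h1 : (j : ℝ) * ε < (j' + 1) * ε := by linarith [h.1, h'.2]
    have h2 : (j' : ℝ) * ε < (j + 1) * ε := by linarith [h'.1, h.2]
    have h3 := lt_of_mul_lt_mul_right h1 hε0.le
    have h4 := lt_of_mul_lt_mul_right h2 hε0.le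
    norm_cast at h3 h4
    omega
  have hPA : ∀ t j, t ∈ P j → t ∉ A := fun t j h h' => h'.2 (mem_iUnion.2 ⟨j, h⟩)
  have hUA : U ⊆ A := greedy_subset _ _ _
  have hLA : L ⊆ A \ U := greedy_subset _ _ _
  obtain ⟨S, hS⟩ := exists_schedule_assignment (V := fun _ => P) (U := fun _ => U) (B := B)
    (fun _ => hPm) (fun _ => hUm) hBm (fun _ => hPP) (fun m t j h h' => hPA t j h (hUA h'))
    (fun m t j h h' => hPA t j h (hLA (hBL m h')).1) (fun m t h h' => (hLA (hBL m h')).2 h)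
  have hsl : ∀ t, S.service last 0 t = volume.real (L ∩ Ico 0 t) := by
    intro t
    rw [service_last hS, Finset.sum_eq_single (⟨0, hM⟩ : Fin M)]
    · simp [B]
    · intro m _ hm
      simp [B, hm]
    · simp
  -- Each periodic job starts at its release and runs without interruption, so it is pending exactly
  -- while it runs.
  have hpp : ∀ (m : Fin M) j t, 0 ≤ t → (S.Pending J (periodicTask m) j t ↔ t ∈ P j) := by
    intro m j t ht
    have hj : 0 ≤ (j : ℝ) * ε := by positivity
    rw [Schedule.Pending, hrp, hep, service_periodicTask hS, ENNReal.ofReal_le_ofReal_iff ht,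
      measureReal_Ico_inter_lt_iff hj (by positivity)]
    rfl
  have hpo : ∀ (m : Fin M) j t, 0 ≤ t →
      (S.Pending J (oneShotTask m) j t ↔ j = 0 ∧ volume.real (A ∩ Ico 0 t) < 1 / 3) := by
    intro m j t ht
    cases j with
    | succ j => simp [Schedule.Pending, hro']
    | zero =>
      rw [Schedule.Pending, hro, heo, service_oneShotTask hS,
        measureReal_greedy_inter ENNReal.zero_ne_top (by norm_num)]
      simp
  have hpl : ∀ j t, 0 ≤ t →
      (S.Pending J last j t ↔ j = 0 ∧ volume.real ((A \ U) ∩ Ico 0 t) < (1 + ε) / 3) := by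
    intro j t ht
    cases j with
    | succ j => simp [Schedule.Pending, hrl']
    | zero =>
      rw [Schedule.Pending, hrl, hel, hsl,
        measureReal_greedy_inter ENNReal.zero_ne_top he3]
      simp
  have hmemU : ∀ t, 0 ≤ t → (t ∈ U ↔ t ∈ A ∧ volume.real (A ∩ Ico 0 t) < 1 / 3) := by
    intro t ht
    simp [U, greedy, ht]
  have hmemL : ∀ t, 0 ≤ t →
      (t ∈ L ↔ t ∈ A \ U ∧ volume.real ((A \ U) ∩ Ico 0 t) < (1 + ε) / 3) := by
    intro t ht
    simp [L, greedy, ht]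
  have hnotA : ∀ t, 0 ≤ t → t ∉ A → ∃ j, t ∈ P j := fun t ht h => by
    by_contra hj
    exact h ⟨ht, fun h' => hj (mem_iUnion.1 h')⟩
  have hpo_prio : ∀ m m' : Fin M, prio (periodicTask m) < prio (oneShotTask m') := fun m m' =>
    hprio _ _ (by simp [adTasks_periodicTask, adTasks_oneShotTask, hη])
  have hpl_prio : ∀ m : Fin M, prio (periodicTask m) < prio last := fun m =>
    hprio _ _ (by simp [adTasks_periodicTask, hlast, adTasks_last, hη])
  have hol_prio : ∀ m : Fin M, prio (oneShotTask m) < prio last := fun m =>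
    hprio _ _ (by simp only [adTasks_oneShotTask, hlast, adTasks_last]; linarith)
  have hrange : ∀ (i : Fin (2 * M + 1)) (t : ℝ) (f : Fin M → Fin (2 * M + 1)),
      Function.Injective f → (∀ m, S.Active J (f m) t ∧ prio (f m) < prio i) →
      ¬ {k | S.Active J k t ∧ prio k < prio i}.ncard < M := by
    intro i t f hf h
    refine not_lt.2 (le_ncard_of_range_subset hf ?_)
    rintro _ ⟨m, rfl⟩
    exact h m
  have hpinj : Function.Injective (periodicTask (M := M)) := fun _ _ h => periodicTask_inj.1 h
  have hoinj : Function.Injective (oneShotTask (M := M)) := fun _ _ h => oneShotTask_inj.1 h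
  have hsched : S.IsScheduleOf J := by
    refine isScheduleOf_assignment hS (fun m t j ht h => ?_) (fun m t ht h => ?_)
      (fun m t ht h => ?_) (fun m m' t h h' => ?_)
    · rw [← service_periodicTask hS]
      exact (hpp m j t ht).2 h
    · rw [← service_oneShotTask hS]
      exact (hpo m 0 t ht).2 ⟨rfl, ((hmemU t ht).1 h).2⟩
    · rw [← service_last hS]
      exact (hpl 0 t ht).2 ⟨rfl, ((hmemL t ht).1 (hBL m h)).2⟩
    · simp only [B] at h h'
      split_ifs at h h' with h1 h2
      · rw [h1, h2]
      · exact h'.elim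
      · exact h.elim
      · exact h.elim
  refine ⟨S, ⟨hsched, fun t ht i j => ?_⟩, ?_⟩
  · simp only [hS]
    rcases task_cases i with ⟨m, rfl⟩ | ⟨m, rfl⟩ | rfl
    · simp only [assignment_periodicTask, hpp m _ t ht]
      constructor
      · rintro ⟨m', h⟩
        split_ifs at h with hm
        · refine ⟨h, fun j' hj' h' => hj'.ne (hPP t _ _ h' h),
            ncard_range_lt m ?_ fun h' => lt_irrefl _ h'.2⟩
          rintro k ⟨-, hk⟩
          rcases task_cases k with ⟨m', rfl⟩ | ⟨m', rfl⟩ | rfl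
          · exact ⟨m', rfl⟩
          · exact absurd hk (hpo_prio _ _).not_gt
          · exact absurd hk (hpl_prio _).not_gt
        · exact h.elim
      · rintro ⟨h, -⟩
        exact ⟨m, by simpa using h⟩
    · simp only [assignment_oneShotTask, hpo m _ t ht]
      constructor
      · rintro ⟨m', h⟩
        split_ifs at h with hm
        · obtain ⟨-, rfl⟩ := hm
          refine ⟨⟨rfl, ((hmemU t ht).1 h).2⟩, fun j' hj' => absurd hj' (Nat.not_lt_zero _),
            ncard_range_lt m ?_ fun h' => lt_irrefl _ h'.2⟩
          rintro k ⟨⟨j', hk⟩, hk'⟩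
          rcases task_cases k with ⟨m', rfl⟩ | ⟨m', rfl⟩ | rfl
          · exact absurd (hUA h) (hPA t j' ((hpp m' j' t ht).1 hk))
          · exact ⟨m', rfl⟩
          · exact absurd hk' (hol_prio _).not_gt
        · exact h.elim
      · rintro ⟨⟨rfl, h⟩, -, hcard⟩
        refine ⟨m, ?_⟩
        rw [if_pos ⟨rfl, rfl⟩, hmemU t ht]
        refine ⟨?_, h⟩
        -- Outside `A` all `M` periodic tasks are active, which contradicts the count `hcard`.
        by_contra hA
        obtain ⟨j, hj⟩ := hnotA t ht hA
        exact hrange _ t periodicTask hpinj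
          (fun m' => ⟨⟨j, (hpp m' j t ht).2 hj⟩, hpo_prio _ _⟩) hcard
    · simp only [assignment_last]
      rw [← hlast]
      simp only [hpl _ t ht]
      constructor
      · rintro ⟨m', h⟩
        split_ifs at h with hj
        · subst hj
          have hL := hBL _ h
          refine ⟨⟨rfl, ((hmemL t ht).1 hL).2⟩, fun j' hj' => absurd hj' (Nat.not_lt_zero _), ?_⟩
          have : {k | S.Active J k t ∧ prio k < prio last} = ∅ := by
            refine eq_empty_of_forall_notMem ?_
            rintro k ⟨⟨j', hk⟩, hk'⟩
            rcases task_cases k with ⟨m', rfl⟩ | ⟨m', rfl⟩ | rfl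
            · exact hPA t j' ((hpp m' j' t ht).1 hk) (hLA hL).1
            · exact (hLA hL).2 ((hmemU t ht).2 ⟨(hLA hL).1, ((hpo m' j' t ht).1 hk).2⟩)
            · exact lt_irrefl _ hk'
          rw [this, ncard_empty]
          exact hM
        · exact h.elim
      · rintro ⟨⟨rfl, h⟩, -, hcard⟩
        refine ⟨⟨0, hM⟩, ?_⟩
        simp only [if_true, B]
        rw [hmemL t ht]
        have hA : t ∈ A := by
          by_contra hA
          obtain ⟨j, hj⟩ := hnotA t ht hA
          exact hrange _ t periodicTask hpinj
            (fun m' => ⟨⟨j, (hpp m' j t ht).2 hj⟩, hpl_prio _⟩) hcard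
        refine ⟨⟨hA, fun hU => ?_⟩, h⟩
        exact hrange _ t oneShotTask hoinj
          (fun m' => ⟨⟨0, (hpo m' 0 t ht).2 ⟨rfl, ((hmemU t ht).1 hU).2⟩⟩, hol_prio _⟩) hcard
  · intro hmeet
    have h0 := hmeet (by rw [hrl]; exact ENNReal.zero_ne_top)
    rw [hrl, hel, hsl, hlast, adTasks_last, measureReal_greedy_inter ENNReal.zero_ne_top he3,
      le_min_iff] at h0
    simp only [ENNReal.toReal_zero, zero_add] at h0
    set x := 1 + 2 * η with hx
    have hAx : volume.real (A ∩ Ico 0 x) ≤ 2 / 3 := by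
      have hsub : A ∩ Ico 0 x ⊆ ⋃ k ∈ Finset.range n, Ico (k * ε + ε / 3) (k * ε + ε) := by
        rintro t ⟨hA, ht0, htx⟩
        have h1 := Nat.floor_le (div_nonneg ht0 hε0.le)
        have h2 := Nat.lt_floor_add_one (t / ε)
        set k := ⌊t / ε⌋₊
        rw [le_div_iff₀ hε0] at h1
        rw [div_lt_iff₀ hε0] at h2
        have h3 : k * ε + ε / 3 ≤ t := by
          by_contra h
          exact hPA t k ⟨h1, not_le.1 h⟩ hA
        -- This is where `η < ε / 6` matters: `[1, 1 + 2 * η)` lies inside the execution of the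
        -- periodic jobs released at `n * ε = 1`, so the extra `2 * η` adds no free time.
        have h4 : k < n := by
          by_contra h
          have h5 : (n : ℝ) * ε ≤ k * ε := by
            have : (n : ℝ) ≤ k := by exact_mod_cast not_lt.1 h
            gcongr
          linarith
        refine mem_biUnion (Finset.mem_coe.2 (Finset.mem_range.2 h4)) ⟨h3, by linarith⟩
      have hfin : volume (⋃ k ∈ Finset.range n, Ico ((k : ℝ) * ε + ε / 3) (k * ε + ε)) ≠ ∞ :=
        (measure_biUnion_lt_top (Finset.finite_toSet _) (fun _ _ => by simp)).ne
      refine (measureReal_mono hsub hfin).trans ((measureReal_biUnion_finset_le _ _).trans ?_)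
      have : ∀ k ∈ Finset.range n, volume.real (Ico ((k : ℝ) * ε + ε / 3) (k * ε + ε)) =
          2 / 3 * ε := fun k _ => by
        rw [Real.volume_real_Ico_of_le (by linarith)]
        ring
      rw [Finset.sum_congr rfl this]
      simp only [Finset.sum_const, Finset.card_range, nsmul_eq_mul]
      linarith
    have hsplit : volume.real (A ∩ Ico 0 x) =
        volume.real (U ∩ Ico 0 x) + volume.real ((A \ U) ∩ Ico 0 x) := by
      rw [← measureReal_union (Disjoint.mono inter_subset_left inter_subset_left
        disjoint_sdiff_right) ((hAm.diff hUm).inter measurableSet_Ico)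
        (ne_top_of_le_ne_top (by simp) (measure_mono inter_subset_right))
        (ne_top_of_le_ne_top (by simp) (measure_mono inter_subset_right)),
        ← union_inter_distrib_right, union_sdiff_cancel hUA]
    have hUx : volume.real (U ∩ Ico 0 x) = min (volume.real (A ∩ Ico 0 x)) (1 / 3) :=
      measureReal_greedy_inter ENNReal.zero_ne_top (by norm_num) x
    -- Either the one-shot tasks took all of `A`, or they took 1/3 and left at most 1/3; both are
    -- less than `(1 + ε) / 3`.
    rcases min_choice (volume.real (A ∩ Ico 0 x)) (1 / 3) with h | h <;> rw [h] at hUx <;>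
      linarith [h0.1]

/-! ### The lower bound on the speedup. -/

theorem legal_synchronous {N : ℕ} {τ : Fin N → Task} (hτ : ∀ i, 0 < (τ i).C) :
    (synchronous τ).Legal τ :=
  ⟨fun i j => by simp [synchronous, add_mul], fun i _ => ⟨hτ i, le_rfl⟩⟩

theorem SemiPartitionedFeasible.feasible {M N : ℕ} {τ : Fin N → Task} {b : Fin N → Fin M → ℝ}
    (h : SemiPartitionedFeasible M τ b) : Feasible M τ := fun J hJ =>
  let ⟨S, h1, h2, _⟩ := h.2.2 J hJ
  ⟨S, h1, h2⟩

theorem valid_atSpeed_adTasks {M : ℕ} {ε η v : ℝ} (hε : 0 < ε) (hη : 0 < η) (hv : (1 + ε) / 3 ≤ v)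
    (i : Fin (2 * M + 1)) : (atSpeed v (adTasks M ε η) i).Valid := by
  have hv0 : 0 < v := by linarith
  rcases task_cases i with ⟨m, rfl⟩ | ⟨m, rfl⟩ | rfl
  · simp only [Task.Valid, atSpeed, adTasks_periodicTask]
    refine ⟨by positivity, one_pos, by simpa using hε, ?_, ENNReal.ofReal_le_ofReal ?_⟩
    · rw [div_le_one hv0]
      linarith
    · rw [div_le_iff₀ hv0]
      nlinarith
  · simp only [Task.Valid, atSpeed, adTasks_oneShotTask]
    refine ⟨by positivity, by positivity, by simp, ?_, le_top⟩
    have : 1 / 3 / v ≤ 1 := by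
      rw [div_le_one hv0]
      linarith
    linarith
  · simp only [Task.Valid, atSpeed, adTasks_last]
    refine ⟨by positivity, by positivity, by simp, ?_, le_top⟩
    have : (1 + ε) / 3 / v ≤ 1 := by
      rw [div_le_one hv0]
      linarith
    linarith

/-- The execution times are scaled so that the set is feasible at unit speed, while speed `s`
restores `adTasks`, for which global DM fails. -/
theorem le_of_hasSpeedupBound {M : ℕ} (hM : 0 < M) (rule : DMRule) {s : ℝ}
    (h : HasSpeedupBound M rule s) : 3 - 3 / ((M : ℝ) + 1) ≤ s := by
  obtain ⟨hs, h⟩ := h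
  by_contra! hlt
  have hM0 : (0 : ℝ) < M := by exact_mod_cast hM
  have hlim : 0 < 3 * M / ((M + 1) * s) - 1 := by
    have h1 : 3 - 3 / ((M : ℝ) + 1) = 3 * M / (M + 1) := by
      field_simp
      ring
    rw [h1] at hlt
    rw [sub_pos, lt_div_iff₀ (by positivity), one_mul, mul_comm]
    rwa [lt_div_iff₀ (by positivity)] at hlt
  -- The period must be the reciprocal of an integer so that time 1 is a release time.
  obtain ⟨k, hk⟩ := exists_nat_one_div_lt hlim
  set ε : ℝ := 1 / (((k + 1 : ℕ) : ℝ)) with hε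
  have hk' : ε < 3 * M / ((M + 1) * s) - 1 := by
    rw [hε]
    push_cast
    exact hk
  have hε0 : 0 < ε := by rw [hε]; positivity
  -- Since `s < 3 * M / (M + 1)`, speed `1 / s` exceeds the limit `(M + 1) / (3 * M)` of the
  -- required speeds, and a small `ε` fits in between.
  have hv : (1 + ε) / 3 + (1 + ε) / (3 * (M : ℝ)) ≤ 1 / s := by
    have h1 : 1 + ε < 3 * M / ((M + 1) * s) := by linarith
    rw [lt_div_iff₀ (by positivity)] at h1
    rw [le_div_iff₀ hs]
    have h2 : ((1 + ε) / 3 + (1 + ε) / (3 * (M : ℝ))) * s = (1 + ε) * ((M + 1) * s) / (3 * M) := by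
      field_simp
    rw [h2, div_le_one (by positivity)]
    exact h1.le
  have hη0 : 0 < ε / 12 := by positivity
  have hv3 : (1 + ε) / 3 ≤ 1 / s := by
    have : 0 < (1 + ε) / (3 * (M : ℝ)) := by positivity
    linarith
  have hsched := h (2 * M + 1) (atSpeed (1 / s) (adTasks M ε (ε / 12)))
    (valid_atSpeed_adTasks hε0 hη0 hv3)
    (semiPartitionedFeasible_adTasks hM hε0 hη0 hv).feasible
  have hτ : atSpeed s (atSpeed (1 / s) (adTasks M ε (ε / 12))) = adTasks M ε (ε / 12) := by
    funext i
    have : (adTasks M ε (ε / 12) i).C / (1 / s) / s = (adTasks M ε (ε / 12) i).C := by field_simp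
    simp only [atSpeed, this]
  rw [hτ] at hsched
  obtain ⟨S, hS, hmiss⟩ := exists_isGlobalFP_adTasks hM (Nat.succ_pos k) hε hη0 (by linarith)
    _ (rule.isDM _ (adTasks M ε (ε / 12)))
  refine hmiss (hsched _ (legal_synchronous fun i => ?_) S hS _ _)
  rcases task_cases i with ⟨m, rfl⟩ | ⟨m, rfl⟩ | rfl
  · rw [adTasks_periodicTask]; positivity
  · rw [adTasks_oneShotTask]; positivity
  · rw [adTasks_last]; positivity

end GlobalDM

theorem theorem5p4 (M : ℕ) (hM : 2 ≤ M) :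
    (∀ (rule : GlobalDM.DMRule) (s : ℝ),
      GlobalDM.HasSpeedupBound M rule s → 3 - 3 / ((M : ℝ) + 1) ≤ s) ∧
    (∀ (n : ℕ) (ε : ℝ), 0 < n → ε = 1 / (n : ℝ) →
      ∃ η₀ : ℝ, 0 < η₀ ∧ ∀ η : ℝ, 0 < η → η < η₀ →
        (∀ prio : Equiv.Perm (Fin (2 * M + 1)), GlobalDM.IsDM (GlobalDM.adTasks M ε η) prio →
          ∃ S : GlobalDM.Schedule M (2 * M + 1),
            S.IsGlobalFP (GlobalDM.synchronous (GlobalDM.adTasks M ε η)) prio ∧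
            ¬ S.MeetsDeadline (GlobalDM.adTasks M ε η)
                (GlobalDM.synchronous (GlobalDM.adTasks M ε η)) (Fin.last (2 * M)) 0) ∧
        (∀ v : ℝ, (1 + ε) / 3 + (1 + ε) / (3 * (M : ℝ)) ≤ v →
          GlobalDM.SemiPartitionedFeasible M
            (GlobalDM.atSpeed v (GlobalDM.adTasks M ε η))
            (GlobalDM.adSplit M (GlobalDM.atSpeed v (GlobalDM.adTasks M ε η))))) := by
  have hM0 : 0 < M := by omega
  refine ⟨fun rule s h => GlobalDM.le_of_hasSpeedupBound hM0 rule h, fun n ε hn hε => ?_⟩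
  have hε0 : 0 < ε := by rw [hε]; positivity
  refine ⟨ε / 6, by positivity, fun η hη hη' => ⟨fun prio hprio => ?_, fun v hv => ?_⟩⟩
  · exact GlobalDM.exists_isGlobalFP_adTasks hM0 hn hε hη hη' prio hprio
  · exact GlobalDM.semiPartitionedFeasible_adTasks hM0 hε0 hη hv
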